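/- Let $d\ge 1$ and let $A$ be a diagonal $d\times d$ matrix with $a_{k,k}>0$ for all $k$; let $\Omega=A\,\mathbb S^{d-1}$ be the ellipsoid that is the image of the Euclidean unit sphere under $x\mapsto Ax$. Let $R$ be a Weibull distributed random variable with parameter $\beta\in(0,1)$, i.e. $\mathbb P(R>x)=e^{-cx^\beta}$ for $x\ge 0$ with some $c>0$, and let $h$ be an increasing concave function on $(0,\infty)$ with $h(x)=o(x)$, $\log x=o(h(x))$ and $-\log\mathbb P(R>x)\sim h(x)$ as $x\to\infty$ (for instance $h(x)=cx^\beta$). Let $\Theta$ be a random vector with values in $\Omega$ such that $\mathbb E(R\Theta)=0$ and, for every Borel set $S\subset\Omega$ of positive surface measure, $\mathbb P(\Theta\in S)>0$ and $\lim_{x\to\infty}\mathbb P(\Theta\in S\mid R>x)=\mathbb P(\Theta\in S)$. Let $X_1,X_2,\dots$ be i.i.d. random vectors distributed as $R\Theta$ and let $S_n=X_1+\dots+X_n$. Let $\mathcal Q$ be the set of diagonal $d\times d$ matrices with all diagonal entries in $(0,1]$ and at least one diagonal entry equal to $1$. For a vector $p$ with $p_j>0$ for all $j$, let $p(Q)=\sum_{j=1}^d(1-q_{j,j})p_j$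 be the premium of $Q\in\mathcal Q$. Then for every $a>0$ the limits $$L_0=\lim_{n\to\infty}\frac{\log\mathbb P(\|S_n/n\|_2>a)}{h(n)},\qquad L(\tilde Q)=\lim_{n\to\infty}\frac{\log\mathbb P(\|\tilde Q S_n/n\|_2>a)}{h(n)}\quad(\tilde Q\in\mathcal Q)$$ exist and are finite, and the matrix $Q=(\min_{j}a_{j,j})\,A^{-1}$ belongs to $\mathcal Q$ and satisfies: 1. $L_0\ge L(Q)$; 2. $L(Q)\le L(\tilde Q)$ for all $\tilde Q\in\mathcal Q$, i.e. $Q$ minimises $L$ over $\mathcal Q$; 3. $Q$ is the unique minimiser of $L$ over $\mathcal Q$ with minimal premium: if $\tilde Q\in\mathcal Q$ also minimises $L$ over $\mathcal Q$ and $\tilde Q\ne Q$, then $p(Q)<p(\tilde Q)$. -/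

import Mathlib

open MeasureTheory ProbabilityTheory Filter Topology Asymptotics

namespace QuotaShare

noncomputable section

/-- The ellipsoid `A (𝕊^{d-1})`, the image of the Euclidean unit sphere under `x ↦ A x`. -/
def ellipsoid {d : ℕ} (A : Matrix (Fin d) (Fin d) ℝ) : Set (EuclideanSpace ℝ (Fin d)) :=
  (fun x => Matrix.toEuclideanLin A x) '' Metric.sphere 0 1

/-- `R` has a Weibull distribution with shape `β` and rate constant `c`:
`P(R > x) = exp (-c x^β)` for all `x ≥ 0` (in particular `R > 0` almost surely). -/
def IsWeibull {Ω : Type*} [MeasurableSpace Ω] (μ : Measure Ω) (R : Ω → ℝ) (β c : ℝ) : Prop :=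
  ∀ x : ℝ, 0 ≤ x → μ.real {ω | x < R ω} = Real.exp (-(c * x ^ β))

/-- `h` is an increasing, concave function on the positive half-line with `h(x) = o(x)` and
`log x = o(h(x))` that describes the logarithmic tail of `R`: `-log P(R > x) ∼ h(x)`. -/
structure IsLogTail {Ω : Type*} [MeasurableSpace Ω] (μ : Measure Ω) (R : Ω → ℝ) (h : ℝ → ℝ) :
    Prop where
  mono : MonotoneOn h (Set.Ioi 0)
  concave : ConcaveOn ℝ (Set.Ioi 0) h
  isLittleO_id : h =o[atTop] (fun x : ℝ => x)
  log_isLittleO : Real.log =o[atTop] h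
  equiv : (fun x : ℝ => -Real.log (μ.real {ω | x < R ω})) ~[atTop] h

/-- The distributional assumption on the angular variable `Θ` on the surface `E ⊆ ℝ^d`:
`Θ` lives on `E`, the mean of `R Θ` exists and vanishes, every Borel subset of `E` with positive
surface measure (the `(d-1)`-dimensional Hausdorff measure) is charged by `Θ`, and `Θ` is
asymptotically independent of `R`. -/
structure IsAngular {d : ℕ} {Ω : Type*} [MeasurableSpace Ω] (μ : Measure Ω) (R : Ω → ℝ)
    (Θ : Ω → EuclideanSpace ℝ (Fin d)) (E : Set (EuclideanSpace ℝ (Fin d))) : Prop where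
  mem : ∀ᵐ ω ∂μ, Θ ω ∈ E
  integrable : Integrable (fun ω => R ω • Θ ω) μ
  mean_zero : ∫ ω, R ω • Θ ω ∂μ = 0
  pos : ∀ S ⊆ E, MeasurableSet S → 0 < μH[(d : ℝ) - 1] S → 0 < μ (Θ ⁻¹' S)
  asymp_indep : ∀ S ⊆ E, MeasurableSet S → 0 < μH[(d : ℝ) - 1] S →
    Tendsto (fun x : ℝ => ProbabilityTheory.cond μ {ω | x < R ω} (Θ ⁻¹' S)) atTop
      (𝓝 (μ (Θ ⁻¹' S)))

/-- The averages `S_n / n`, where `S_n` is the sum of the first `n` increments. -/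
def walkMean {d : ℕ} {Ω : Type*} (X : ℕ → Ω → EuclideanSpace ℝ (Fin d)) (n : ℕ) (ω : Ω) :
    EuclideanSpace ℝ (Fin d) :=
  (n : ℝ)⁻¹ • ∑ i ∈ Finset.range n, X i ω

/-- `lim_n log P(‖Y_n‖ > a) / h(n)` exists and equals the real number `L`; the probabilities are
required to be eventually positive, so that the logarithms are genuine. -/
def HasLogRuinLimit {d : ℕ} {Ω : Type*} [MeasurableSpace Ω] (P : Measure Ω) (h : ℝ → ℝ) (a : ℝ)
    (Y : ℕ → Ω → EuclideanSpace ℝ (Fin d)) (L : ℝ) : Prop :=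
  (∀ᶠ n in atTop, 0 < P {ω | a < ‖Y n ω‖}) ∧
    Tendsto (fun n : ℕ => Real.log (P.real {ω | a < ‖Y n ω‖}) / h n) atTop (𝓝 L)

/-- Quota share strategies of the ceding company: diagonal matrices with diagonal entries in
`(0, 1]`, at least one of which equals `1`. -/
def strategies (d : ℕ) : Set (Matrix (Fin d) (Fin d) ℝ) :=
  {Q | Q.IsDiag ∧ (∀ k, 0 < Q k k ∧ Q k k ≤ 1) ∧ ∃ k, Q k k = 1}

/-- The premium `p(Q) = ∑_j (1 - q_jj) p_j`. -/
def premium {d : ℕ} (p : Fin d → ℝ) (Q : Matrix (Fin d) (Fin d) ℝ) : ℝ :=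
  ∑ j, (1 - Q j j) * p j

/-- The strategy `(min_j a_jj) A⁻¹`. The infimum runs over a finite index set and is a minimum
for `d ≥ 1`. -/
def optimalStrategy {d : ℕ} (A : Matrix (Fin d) (Fin d) ℝ) : Matrix (Fin d) (Fin d) ℝ :=
  (⨅ j, A j j) • A⁻¹

end

end QuotaShare

namespace QuotaShare

/-! ### Elementary inequalities and growth rates -/

/-! The argument is the principle of a single big jump. Let `M` be the largest semi-axis `max_k q_kk
a_kk` of the ellipsoid `Q A 𝕊^{d-1}`. Since `‖Q R Θ‖ ≤ M R`, the cheapest way for the mean to exceed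
`a` is one increment with `R ≈ n a / M` pointing near the tip of a longest axis, at cost `exp (-c (a
/ M)^β n^β)`. As `h(x) ∼ c x^β`, this gives `L(Q) = -(a / M)^β`.

The upper bound (`decaysAtRate_norm_sum`) covers the outside of a ball by finitely many half-spaces
and applies truncation and a Chernoff bound to each projection (`decaysAtRate_sum`). The lower bound
(`eventually_exp_le_norm_sum`) combines one big jump with the law of large numbers for the other
increments.

Minimising `L` is then minimising `M`. Some entry of a strategy is `1`, so `M ≥ min_j a_jj`, and
`(min_j a_jj) A⁻¹` attains this by turning the ellipsoid into a sphere. A strategy attaining it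
satisfies `q_jj ≤ min_i a_ii / a_jj` for every `j`, hence cedes at least as much in each coordinate
and pays at least as much premium. -/

theorem exp_le_one_add_add_sq_mul_exp (x : ℝ) :
    Real.exp x ≤ 1 + x + x ^ 2 * Real.exp (max x 0) := by
  have hm : 1 ≤ Real.exp (max x 0) := Real.one_le_exp (le_max_right _ _)
  have hs : x ^ 2 ≤ x ^ 2 * Real.exp (max x 0) := le_mul_of_one_le_right (sq_nonneg x) hm
  by_cases hx : |x| ≤ 1
  · have := (abs_le.1 (Real.abs_exp_sub_one_sub_id_le hx)).2
    linarith
  · rcases lt_abs.1 (not_le.1 hx) with h1 | h1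
    · rw [max_eq_left (by linarith : (0 : ℝ) ≤ x)]
      have h2 : 1 * Real.exp x ≤ x ^ 2 * Real.exp x := by
        gcongr; nlinarith
      linarith
    · have : Real.exp x ≤ 1 := Real.exp_le_one_iff.2 (by linarith)
      nlinarith

/-- `f` decays at least as fast as `exp (-κ n ^ β)` for each `κ < κ₀`. -/
def DecaysAtRate (β κ₀ : ℝ) (f : ℕ → ℝ) : Prop :=
  ∀ κ < κ₀, ∀ᶠ n : ℕ in atTop, f n ≤ Real.exp (-(κ * (n : ℝ) ^ β))

theorem tendsto_natCast_rpow {β : ℝ} (hβ : 0 < β) :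
    Tendsto (fun n : ℕ => (n : ℝ) ^ β) atTop atTop :=
  (tendsto_rpow_atTop hβ).comp tendsto_natCast_atTop_atTop

theorem eventually_natCast_le_exp {β δ : ℝ} (hβ : 0 < β) (hδ : 0 < δ) :
    ∀ᶠ n : ℕ in atTop, (n : ℝ) ≤ Real.exp (δ * (n : ℝ) ^ β) := by
  have h := ((isLittleO_log_rpow_atTop hβ).bound hδ)
  filter_upwards [tendsto_natCast_atTop_atTop.eventually h, eventually_gt_atTop 0] with n hn hn0
  have hn0' : (0 : ℝ) < n := by exact_mod_cast hn0
  rw [Real.norm_eq_abs, Real.norm_eq_abs, abs_of_nonneg (Real.rpow_nonneg hn0'.le β)] at hn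
  calc (n : ℝ) = Real.exp (Real.log n) := (Real.exp_log hn0').symm
    _ ≤ _ := Real.exp_le_exp.2 ((le_abs_self _).trans hn)

theorem eventually_const_le_exp {β δ : ℝ} (hβ : 0 < β) (hδ : 0 < δ) (C : ℝ) :
    ∀ᶠ n : ℕ in atTop, C ≤ Real.exp (δ * (n : ℝ) ^ β) := by
  filter_upwards [eventually_natCast_le_exp hβ hδ,
    tendsto_natCast_atTop_atTop.eventually (eventually_ge_atTop C)] with n h1 h2
  exact h2.trans h1

namespace DecaysAtRate

variable {β κ₀ : ℝ} {f g : ℕ → ℝ}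

theorem mono (hg : DecaysAtRate β κ₀ g) (hfg : ∀ᶠ n in atTop, f n ≤ g n) :
    DecaysAtRate β κ₀ f := fun κ hκ => by
  filter_upwards [hg κ hκ, hfg] with n h1 h2
  exact h2.trans h1

theorem of_forall_lt (h : ∀ κ < κ₀, DecaysAtRate β κ f) : DecaysAtRate β κ₀ f := fun κ hκ =>
  h ((κ + κ₀) / 2) (by linarith) κ (by linarith)

theorem exp_neg : DecaysAtRate β κ₀ (fun n => Real.exp (-(κ₀ * (n : ℝ) ^ β))) := fun _ hκ =>
  .of_forall fun n => Real.exp_le_exp.2 <| neg_le_neg <|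
    mul_le_mul_of_nonneg_right hκ.le (Real.rpow_nonneg n.cast_nonneg β)

/-- Only rates strictly below `κ₀` are claimed, so half of the gap `κ₀ - κ` can pay for any
subexponential factor. -/
theorem of_mul_exp {s : ℕ → ℝ} (hf : DecaysAtRate β κ₀ f)
    (hs0 : ∀ n, 0 ≤ s n)
    (hs : ∀ δ > 0, ∀ᶠ n : ℕ in atTop, s n ≤ Real.exp (δ * (n : ℝ) ^ β)) :
    DecaysAtRate β κ₀ (fun n => s n * f n) := fun κ hκ => by
  filter_upwards [hf ((κ + κ₀) / 2) (by linarith), hs ((κ₀ - κ) / 2) (by linarith)] with n h1 h2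
  calc s n * f n ≤ Real.exp ((κ₀ - κ) / 2 * (n : ℝ) ^ β) *
        Real.exp (-((κ + κ₀) / 2 * (n : ℝ) ^ β)) :=
        (mul_le_mul_of_nonneg_left h1 (hs0 n)).trans
          (mul_le_mul_of_nonneg_right h2 (Real.exp_pos _).le)
    _ = _ := by rw [← Real.exp_add]; congr 1; ring

theorem natCast_mul (hβ : 0 < β) (hf : DecaysAtRate β κ₀ f) :
    DecaysAtRate β κ₀ (fun n => n * f n) :=
  hf.of_mul_exp (fun n => Nat.cast_nonneg n) fun _ hδ => eventually_natCast_le_exp hβ hδ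

theorem finset_sum (hβ : 0 < β) {ι : Type*} (t : Finset ι) {f : ι → ℕ → ℝ}
    (hf : ∀ i ∈ t, DecaysAtRate β κ₀ (f i)) :
    DecaysAtRate β κ₀ (fun n => ∑ i ∈ t, f i n) := fun κ hκ => by
  have h1 : ∀ᶠ n : ℕ in atTop, ∀ i ∈ t,
      f i n ≤ Real.exp (-((κ + κ₀) / 2 * (n : ℝ) ^ β)) :=
    (Finset.eventually_all t).2 fun i hi => hf i hi ((κ + κ₀) / 2) (by linarith)
  filter_upwards [h1, eventually_const_le_exp hβ (by linarith : 0 < (κ₀ - κ) / 2) t.card]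
    with n h1 h2
  calc ∑ i ∈ t, f i n ≤ t.card * Real.exp (-((κ + κ₀) / 2 * (n : ℝ) ^ β)) := by
        simpa using Finset.sum_le_sum h1
    _ ≤ Real.exp ((κ₀ - κ) / 2 * (n : ℝ) ^ β) * Real.exp (-((κ + κ₀) / 2 * (n : ℝ) ^ β)) := by
        gcongr
    _ = _ := by rw [← Real.exp_add]; congr 1; ring

theorem add (hβ : 0 < β) (hf : DecaysAtRate β κ₀ f) (hg : DecaysAtRate β κ₀ g) :
    DecaysAtRate β κ₀ (fun n => f n + g n) := by
  have := finset_sum hβ Finset.univ (f := fun b : Bool => if b then f else g) (κ₀ := κ₀)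
    (by intro b _; cases b <;> simpa)
  simpa using this

end DecaysAtRate

/-! ### Weibull variables -/

namespace IsWeibull

variable {Ω : Type*} [MeasurableSpace Ω] {μ : Measure Ω} {R : Ω → ℝ} {β c : ℝ}

theorem const_mul (hW : IsWeibull μ R β c) {M : ℝ} (hM : 0 < M) :
    IsWeibull μ (fun ω => M * R ω) β (c / M ^ β) := fun x hx => by
  have : {ω | x < M * R ω} = {ω | x / M < R ω} := by
    ext ω; simp [div_lt_iff₀' hM]
  rw [this, hW _ (div_nonneg hx hM.le), Real.div_rpow hx hM.le]
  congr 1; ring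

variable [IsProbabilityMeasure μ]

theorem ae_pos (hW : IsWeibull μ R β c) (hR : Measurable R) (hβ : 0 < β) :
    ∀ᵐ ω ∂μ, 0 < R ω := by
  have h := hW 0 le_rfl
  rw [Real.zero_rpow hβ.ne', mul_zero, neg_zero, Real.exp_zero] at h
  have h1 : μ {ω | 0 < R ω} = 1 := by
    rwa [measureReal_def, ENNReal.toReal_eq_one_iff] at h
  exact (prob_compl_eq_zero_iff (measurableSet_lt measurable_const hR)).2 h1

/-- Layer-cake formula: for `t > 1` the tail at level `t` is at most `t^(-c/θ)`, integrable at
infinity because `c / θ > 1`. -/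
theorem integrable_exp_rpow (hW : IsWeibull μ R β c) (hR : Measurable R) (hβ : 0 < β)
    {θ : ℝ} (hθ : 0 < θ) (hθc : θ < c) :
    Integrable (fun ω => Real.exp (θ * R ω ^ β)) μ := by
  have hmeas : Measurable fun ω => Real.exp (θ * R ω ^ β) := by fun_prop
  refine ⟨hmeas.aestronglyMeasurable, ?_⟩
  rw [hasFiniteIntegral_iff_ofReal (.of_forall fun ω => (Real.exp_pos _).le),
    lintegral_eq_lintegral_meas_lt μ (.of_forall fun ω => (Real.exp_pos _).le) hmeas.aemeasurable,
    ← Set.Ioc_union_Ioi_eq_Ioi (zero_le_one (α := ℝ)),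
    lintegral_union measurableSet_Ioi (Set.Ioc_disjoint_Ioi le_rfl)]
  refine ENNReal.add_lt_top.2 ⟨?_, ?_⟩
  · calc ∫⁻ t in Set.Ioc (0 : ℝ) 1, μ {a | t < Real.exp (θ * R a ^ β)}
        ≤ ∫⁻ t in Set.Ioc (0 : ℝ) 1, 1 := lintegral_mono fun t => prob_le_one
      _ < ⊤ := by simp
  · have hle : ∀ t ∈ Set.Ioi (1 : ℝ), μ {a | t < Real.exp (θ * R a ^ β)} ≤
        ENNReal.ofReal (t ^ (-(c / θ))) := by
      intro t ht
      have ht1 : (1 : ℝ) < t := ht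
      have ht0 : (0 : ℝ) < t := zero_lt_one.trans ht1
      have hl : 0 ≤ Real.log t / θ := div_nonneg (Real.log_nonneg ht1.le) hθ.le
      have h1 : μ {a | t < Real.exp (θ * R a ^ β)} ≤
          μ {a | (Real.log t / θ) ^ β⁻¹ < R a} := by
        refine measure_mono_ae ?_
        filter_upwards [hW.ae_pos hR hβ] with ω hω hlt
        have h2 : Real.log t < θ * R ω ^ β := (Real.log_lt_iff_lt_exp ht0).2 hlt
        have h3 : Real.log t / θ < R ω ^ β := (div_lt_iff₀' hθ).2 h2
        have h4 := Real.rpow_lt_rpow hl h3 (inv_pos.2 hβ)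
        rwa [Real.rpow_rpow_inv hω.le hβ.ne'] at h4
      refine h1.trans (le_of_eq ?_)
      rw [← ofReal_measureReal, hW _ (Real.rpow_nonneg hl _), Real.rpow_inv_rpow hl hβ.ne',
        Real.rpow_def_of_pos ht0]
      congr 2; field_simp
    calc ∫⁻ t in Set.Ioi (1 : ℝ), μ {a | t < Real.exp (θ * R a ^ β)}
        ≤ ∫⁻ t in Set.Ioi (1 : ℝ), ENNReal.ofReal (t ^ (-(c / θ))) :=
          setLIntegral_mono' measurableSet_Ioi hle
      _ < ⊤ := by
          have hlt : -(c / θ) < -1 := neg_lt_neg ((one_lt_div hθ).2 hθc)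
          exact (integrableOn_Ioi_rpow_of_lt hlt one_pos).lintegral_lt_top

theorem integrable_sq_mul_exp_rpow (hW : IsWeibull μ R β c) (hR : Measurable R) (hβ : 0 < β)
    {θ : ℝ} (hθ : 0 < θ) (hθc : θ < c) :
    Integrable (fun ω => R ω ^ 2 * Real.exp (θ * R ω ^ β)) μ := by
  obtain ⟨m, hm⟩ := exists_nat_ge (2 / β)
  -- Half of the room below `c` absorbs the square: with `W = R^β`, `R² = W^(2/β)` is at most a
  -- constant times `exp (η W)`.
  set η := (c - θ) / 2 with hη
  have hη0 : 0 < η := by rw [hη]; linarith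
  have hint := ((hW.integrable_exp_rpow hR hβ (by linarith : 0 < θ + η)
    (by linarith : θ + η < c)).const_mul (1 + m.factorial / η ^ m))
  refine hint.mono' (by fun_prop) ?_
  filter_upwards [hW.ae_pos hR hβ] with ω hω
  rw [Real.norm_of_nonneg (by positivity), add_mul θ, Real.exp_add, mul_comm (Real.exp _),
    ← mul_assoc]
  gcongr
  set W := R ω ^ β with hWdef
  have hW0 : 0 < W := Real.rpow_pos_of_pos hω β
  have h1 : R ω ^ 2 = W ^ (2 / β) := by
    rw [hWdef, ← Real.rpow_mul hω.le, mul_div_cancel₀ _ hβ.ne', Real.rpow_two]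
  have h2 : W ^ (2 / β) ≤ 1 + W ^ m := by
    rcases le_total W 1 with h | h
    · have := Real.rpow_le_one hW0.le h (by positivity : 0 ≤ 2 / β)
      have := pow_pos hW0 m
      linarith
    · have := Real.rpow_le_rpow_of_exponent_le h hm
      rw [Real.rpow_natCast] at this
      linarith
  have h3 : W ^ m ≤ m.factorial / η ^ m * Real.exp (η * W) := by
    have := Real.pow_div_factorial_le_exp (η * W) (by positivity) m
    rw [div_le_iff₀ (by positivity), mul_pow] at this
    rw [div_mul_eq_mul_div, le_div_iff₀ (by positivity)]
    linarith
  have h4 : 1 ≤ Real.exp (η * W) := Real.one_le_exp (by positivity)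
  rw [h1]
  linarith

end IsWeibull

/-! ### Upper bound for sums of real variables -/

/-- `x` if `x ≤ B`, and `0` otherwise. -/
noncomputable def truncAbove (B x : ℝ) : ℝ := if x ≤ B then x else 0

theorem measurable_truncAbove (B : ℝ) : Measurable (truncAbove B) :=
  Measurable.ite measurableSet_Iic measurable_id measurable_const

theorem truncAbove_of_le {B x : ℝ} (h : x ≤ B) : truncAbove B x = x := if_pos h

theorem truncAbove_le {B : ℝ} (hB : 0 ≤ B) (x : ℝ) : truncAbove B x ≤ B := by
  unfold truncAbove; split_ifs with h <;> assumption

theorem truncAbove_le_self {B : ℝ} (hB : 0 ≤ B) (x : ℝ) : truncAbove B x ≤ x := by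
  unfold truncAbove; split_ifs with h <;> linarith

theorem abs_truncAbove_le (B x : ℝ) : |truncAbove B x| ≤ |x| := by
  unfold truncAbove; split_ifs with h <;> simp

theorem integrable_exp_mul_of_le {Ω : Type*} [MeasurableSpace Ω] {μ : Measure Ω}
    [IsFiniteMeasure μ] {f : Ω → ℝ} (hf : AEMeasurable f μ) {B t : ℝ} (ht : 0 ≤ t)
    (hB : ∀ ω, f ω ≤ B) : Integrable (fun ω => Real.exp (t * f ω)) μ := by
  refine Integrable.of_bound (by fun_prop) (Real.exp (t * B)) (.of_forall fun ω => ?_)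
  rw [Real.norm_of_nonneg (Real.exp_pos _).le]
  exact Real.exp_le_exp.2 (mul_le_mul_of_nonneg_left (hB ω) ht)

section

variable {Ω : Type*} [MeasurableSpace Ω] {μ : Measure Ω} [IsProbabilityMeasure μ]
  {R : Ω → ℝ} {β c : ℝ}

/-- The tilt `t = θ B^(β-1)` is matched to the truncation: for `0 < x ≤ B`, `β < 1` gives `t x ≤ θ
x^β`. The second-order term is therefore dominated by `R² exp (θ R^β)`, whose integral `K` does not
depend on `B`. Truncation only lowers the variable, so the linear term is bounded by the vanishing
mean. -/
theorem exists_mgf_truncAbove_le (hW : IsWeibull μ R β c) (hR : Measurable R) (hβ : 0 < β)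
    (hβ1 : β < 1) {ζ : Ω → ℝ} (hζ : Integrable ζ μ) (hmean : ∫ ω, ζ ω ∂μ = 0)
    (hζR : ∀ᵐ ω ∂μ, |ζ ω| ≤ R ω) {θ : ℝ} (hθ : 0 < θ) (hθc : θ < c) :
    ∃ K : ℝ, 0 ≤ K ∧ ∀ B : ℝ, 0 < B →
      mgf (fun ω => truncAbove B (ζ ω)) μ (θ * B ^ (β - 1)) ≤
        Real.exp ((θ * B ^ (β - 1)) ^ 2 * K) := by
  have hint := hW.integrable_sq_mul_exp_rpow hR hβ hθ hθc
  refine ⟨∫ ω, R ω ^ 2 * Real.exp (θ * R ω ^ β) ∂μ, integral_nonneg fun ω => by positivity,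
    fun B hB => ?_⟩
  set t := θ * B ^ (β - 1) with ht
  have ht0 : 0 < t := by positivity
  have hpt : ∀ᵐ ω ∂μ, Real.exp (t * truncAbove B (ζ ω)) ≤
      1 + t * ζ ω + t ^ 2 * (R ω ^ 2 * Real.exp (θ * R ω ^ β)) := by
    filter_upwards [hζR] with ω hω
    set x := truncAbove B (ζ ω) with hx
    have hxB : x ≤ B := truncAbove_le hB.le _
    have hxR : |x| ≤ R ω := (abs_truncAbove_le _ _).trans hω
    have hR0 : 0 ≤ R ω := (abs_nonneg _).trans hxR
    have h1 : max (t * x) 0 ≤ θ * R ω ^ β := by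
      refine max_le ?_ (by positivity)
      rcases le_or_gt x 0 with h | h
      · exact (mul_nonpos_of_nonneg_of_nonpos ht0.le h).trans (by positivity)
      · have h2 : B ^ (β - 1) ≤ x ^ (β - 1) :=
          Real.rpow_le_rpow_of_nonpos h hxB (by linarith)
        calc t * x ≤ θ * (x ^ (β - 1) * x) := by
              rw [ht, mul_assoc]; gcongr
          _ = θ * x ^ β := by
              rw [← Real.rpow_add_one h.ne']; simp
          _ ≤ _ := by
              gcongr
              exact (le_abs_self x).trans hxR
    have h3 : x ^ 2 ≤ R ω ^ 2 := sq_le_sq' (by linarith [neg_abs_le x]) ((le_abs_self x).trans hxR)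
    calc Real.exp (t * x) ≤ 1 + t * x + (t * x) ^ 2 * Real.exp (max (t * x) 0) :=
          exp_le_one_add_add_sq_mul_exp _
      _ ≤ 1 + t * ζ ω + t ^ 2 * (R ω ^ 2 * Real.exp (θ * R ω ^ β)) := by
          have h4 := mul_le_mul_of_nonneg_left (truncAbove_le_self hB.le (ζ ω)) ht0.le
          have h5 : t ^ 2 * (x ^ 2 * Real.exp (max (t * x) 0)) ≤
              t ^ 2 * (R ω ^ 2 * Real.exp (θ * R ω ^ β)) := by gcongr
          rw [mul_pow, mul_assoc (t ^ 2)]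
          linarith
  have hmeas : AEMeasurable (fun ω => truncAbove B (ζ ω)) μ :=
    (measurable_truncAbove B).comp_aemeasurable hζ.aemeasurable
  have hi1 : Integrable (fun ω => 1 + t * ζ ω) μ := (integrable_const _).add (hζ.const_mul t)
  calc mgf (fun ω => truncAbove B (ζ ω)) μ t
      ≤ ∫ ω, 1 + t * ζ ω + t ^ 2 * (R ω ^ 2 * Real.exp (θ * R ω ^ β)) ∂μ :=
        integral_mono_ae (integrable_exp_mul_of_le hmeas ht0.le fun ω => truncAbove_le hB.le _)
          (hi1.add (hint.const_mul _)) hpt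
    _ = 1 + t ^ 2 * ∫ ω, R ω ^ 2 * Real.exp (θ * R ω ^ β) ∂μ := by
        rw [integral_add hi1 (hint.const_mul _), integral_add (integrable_const _)
          (hζ.const_mul t), integral_const_mul, integral_const_mul, hmean]
        simp
    _ ≤ _ := by
        rw [add_comm]; exact Real.add_one_le_exp _

variable {Ω' : Type*} [MeasurableSpace Ω'] {P : Measure Ω'} [IsProbabilityMeasure P]

/-- Truncate at `B = n b`. Either some summand exceeds `B`, which costs `n exp (-c B^β)`, or the
truncated sum reaches `B`, which by Chernoff costs `exp (-θ B^β)` up to a subexponential factor.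
Then let `θ` tend to `c`. -/
theorem decaysAtRate_sum (hW : IsWeibull μ R β c) (hR : Measurable R) (hβ : 0 < β)
    (hβ1 : β < 1) (hc : 0 < c) {ζ : Ω → ℝ} (hζ : Integrable ζ μ) (hmean : ∫ ω, ζ ω ∂μ = 0)
    (hζR : ∀ᵐ ω ∂μ, |ζ ω| ≤ R ω) {ξ : ℕ → Ω' → ℝ} (hindep : iIndepFun ξ P)
    (hident : ∀ i, IdentDistrib (ξ i) ζ P μ) {b : ℝ} (hb : 0 < b) :
    DecaysAtRate β (c * b ^ β)
      (fun n => P.real {ω | n * b < ∑ i ∈ Finset.range n, ξ i ω}) := by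
  have hbβ : 0 < b ^ β := Real.rpow_pos_of_pos hb β
  refine .of_forall_lt fun κ hκ => ?_
  obtain ⟨θ, hθ1, hθc⟩ : ∃ θ, max (κ / b ^ β) 0 < θ ∧ θ < c :=
    exists_between (max_lt ((div_lt_iff₀ hbβ).2 hκ) hc)
  have hθ : 0 < θ := (le_max_right _ _).trans_lt hθ1
  have hκθ : κ < θ * b ^ β := (div_lt_iff₀ hbβ).1 ((le_max_left _ _).trans_lt hθ1)
  obtain ⟨K, hK0, hK⟩ := exists_mgf_truncAbove_le hW hR hβ hβ1 hζ hmean hζR hθ hθc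
  -- The bound for the product of `n` moment generating functions. Its exponent has order
  -- `n^(2β-1)`, which is `o(n^β)` since `β < 1`.
  set s : ℕ → ℝ := fun n => Real.exp (n * ((θ * (n * b) ^ (β - 1)) ^ 2 * K)) with hs
  have hs_sub : ∀ δ > 0, ∀ᶠ n : ℕ in atTop, s n ≤ Real.exp (δ * (n : ℝ) ^ β) := by
    intro δ hδ
    have h0 : Tendsto (fun n : ℕ => (θ ^ 2 * (b ^ (β - 1)) ^ 2 * K) * (n : ℝ) ^ (β - 1)) atTop
        (𝓝 0) := by
      have := (tendsto_rpow_neg_atTop (by linarith : 0 < 1 - β)).comp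
        (tendsto_natCast_atTop_atTop (R := ℝ))
      simpa using this.const_mul (θ ^ 2 * (b ^ (β - 1)) ^ 2 * K)
    filter_upwards [h0.eventually_le_const hδ, eventually_gt_atTop 0] with n hn hn0
    have hn0' : (0 : ℝ) < n := by exact_mod_cast hn0
    refine Real.exp_le_exp.2 ?_
    have h1 : (n : ℝ) ^ β = n * (n : ℝ) ^ (β - 1) := by
      rw [mul_comm, ← Real.rpow_add_one hn0'.ne']; simp
    calc (n : ℝ) * ((θ * (n * b) ^ (β - 1)) ^ 2 * K)
        = (θ ^ 2 * (b ^ (β - 1)) ^ 2 * K) * (n : ℝ) ^ (β - 1) * (n * (n : ℝ) ^ (β - 1)) := by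
          rw [Real.mul_rpow hn0'.le hb.le]; ring
      _ ≤ δ * (n : ℝ) ^ β := by
          rw [h1]; gcongr
  have hd1 : DecaysAtRate β κ (fun n => n * Real.exp (-(c * b ^ β * (n : ℝ) ^ β))) :=
    DecaysAtRate.natCast_mul hβ fun κ' hκ' => DecaysAtRate.exp_neg κ' (by linarith)
  have hd2 : DecaysAtRate β κ (fun n => s n * Real.exp (-(θ * b ^ β * (n : ℝ) ^ β))) :=
    DecaysAtRate.of_mul_exp (fun κ' hκ' => DecaysAtRate.exp_neg κ' (by linarith))
      (fun n => (Real.exp_pos _).le) hs_sub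
  refine (hd1.add hβ hd2).mono ?_
  filter_upwards [eventually_gt_atTop 0] with n hn0
  have hn0' : (0 : ℝ) < n := by exact_mod_cast hn0
  set B := n * b with hBdef
  have hB : 0 < B := by positivity
  have hBβ : B ^ β = b ^ β * (n : ℝ) ^ β := by
    rw [hBdef, Real.mul_rpow hn0'.le hb.le, mul_comm]
  set η : ℕ → Ω' → ℝ := fun i ω => truncAbove B (ξ i ω) with hη
  have hηm : ∀ i, AEMeasurable (η i) P := fun i =>
    (measurable_truncAbove B).comp_aemeasurable (hident i).aemeasurable_fst
  have hηindep : iIndepFun η P := hindep.comp _ fun _ => measurable_truncAbove B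
  have hηident : ∀ i, IdentDistrib (η i) (fun ω => truncAbove B (ζ ω)) P μ := fun i =>
    (hident i).comp (measurable_truncAbove B)
  have hsub : {ω | B < ∑ i ∈ Finset.range n, ξ i ω} ⊆
      (⋃ i ∈ Finset.range n, {ω | B < ξ i ω}) ∪ {ω | B ≤ (∑ i ∈ Finset.range n, η i) ω} := by
    intro ω hω
    by_cases hmax : ∃ i ∈ Finset.range n, B < ξ i ω
    · left
      simpa using hmax
    · right
      push Not at hmax
      have : ∑ i ∈ Finset.range n, η i ω = ∑ i ∈ Finset.range n, ξ i ω :=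
        Finset.sum_congr rfl fun i hi => truncAbove_of_le (hmax i hi)
      simp only [Set.mem_ofPred_eq, Finset.sum_apply, this]
      exact (show B < _ from hω).le
  have htail : ∀ i, P.real {ω | B < ξ i ω} ≤ Real.exp (-(c * b ^ β * (n : ℝ) ^ β)) := by
    intro i
    have h1 : P.real {ω | B < ξ i ω} = μ.real {ω | B < ζ ω} := by
      rw [measureReal_def, measureReal_def]
      exact congrArg _ ((hident i).measure_mem_eq measurableSet_Ioi)
    rw [h1, mul_assoc, ← hBβ, ← hW B hB.le]
    refine ENNReal.toReal_mono (measure_ne_top _ _) (measure_mono_ae ?_)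
    filter_upwards [hζR] with ω hω hlt
    exact (show B < ζ ω from hlt).trans_le ((le_abs_self _).trans hω)
  set t := θ * B ^ (β - 1) with ht
  have ht0 : 0 ≤ t := by positivity
  have htB : t * B = θ * b ^ β * (n : ℝ) ^ β := by
    rw [ht, mul_assoc, ← Real.rpow_add_one hB.ne', sub_add_cancel, hBβ, mul_assoc]
  have hchernoff : P.real {ω | B ≤ (∑ i ∈ Finset.range n, η i) ω} ≤
      s n * Real.exp (-(θ * b ^ β * (n : ℝ) ^ β)) := by
    have hint : Integrable (fun ω => Real.exp (t * (∑ i ∈ Finset.range n, η i) ω)) P := by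
      refine integrable_exp_mul_of_le (B := n * B)
        (Finset.aemeasurable_sum _ fun i _ => hηm i) ht0 fun ω => ?_
      rw [Finset.sum_apply]
      simpa using Finset.sum_le_card_nsmul (Finset.range n) (fun i => η i ω) B
        fun i _ => truncAbove_le hB.le _
    refine (measure_ge_le_exp_mul_mgf B ht0 hint).trans ?_
    rw [hηindep.mgf_sum₀ hηm, neg_mul, htB, mul_comm]
    gcongr
    calc ∏ i ∈ Finset.range n, mgf (η i) P t
        = (mgf (fun ω => truncAbove B (ζ ω)) μ t) ^ n := by
          simp [mgf_congr_identDistrib (hηident _)]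
      _ ≤ Real.exp (t ^ 2 * K) ^ n := pow_le_pow_left₀ mgf_nonneg (hK B hB) n
      _ = s n := by rw [← Real.exp_nat_mul]
  calc P.real {ω | B < ∑ i ∈ Finset.range n, ξ i ω}
      ≤ P.real ((⋃ i ∈ Finset.range n, {ω | B < ξ i ω}) ∪
          {ω | B ≤ (∑ i ∈ Finset.range n, η i) ω}) := measureReal_mono hsub
    _ ≤ P.real (⋃ i ∈ Finset.range n, {ω | B < ξ i ω}) +
          P.real {ω | B ≤ (∑ i ∈ Finset.range n, η i) ω} := measureReal_union_le _ _
    _ ≤ ∑ i ∈ Finset.range n, P.real {ω | B < ξ i ω} +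
          s n * Real.exp (-(θ * b ^ β * (n : ℝ) ^ β)) :=
        add_le_add (measureReal_biUnion_finset_le _ _) hchernoff
    _ ≤ _ := by
        gcongr
        simpa using Finset.sum_le_card_nsmul (Finset.range n) _ _ fun i _ => htail i

end

/-! ### Upper bound for sums of vectors -/

/-- Take an `ε`-net of the compact unit sphere: a unit vector `w` within `ε` of `u` has `⟪u, w⟫ = 1
- ⟪w - u, w⟫ > 1 - ε`. -/
theorem exists_finset_inner_gt {E : Type*} [NormedAddCommGroup E] [InnerProductSpace ℝ E]
    [FiniteDimensional ℝ E] {ε : ℝ} (hε : 0 < ε) :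
    ∃ t : Finset E, (∀ u ∈ t, ‖u‖ = 1) ∧
      ∀ v : E, v ≠ 0 → ∃ u ∈ t, (1 - ε) * ‖v‖ < inner ℝ u v := by
  obtain ⟨t, ht, hcover⟩ := (isCompact_sphere (0 : E) 1).elim_nhds_subcover
    (fun u => Metric.ball u ε) fun u _ => Metric.ball_mem_nhds u hε
  refine ⟨t, fun u hu => by simpa using ht u hu, fun v hv => ?_⟩
  have hv0 : 0 < ‖v‖ := norm_pos_iff.2 hv
  set w := ‖v‖⁻¹ • v with hw
  have hw1 : ‖w‖ = 1 := by rw [hw, norm_smul, norm_inv, norm_norm, inv_mul_cancel₀ hv0.ne']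
  have hvw : v = ‖v‖ • w := by rw [hw, smul_inv_smul₀ hv0.ne']
  obtain ⟨u, hu, hwu⟩ := Set.mem_iUnion₂.1 (hcover (by simpa using hw1 : w ∈ Metric.sphere 0 1))
  refine ⟨u, hu, ?_⟩
  have h1 : inner ℝ (w - u) w < ε :=
    (real_inner_le_norm _ _).trans_lt (by
      rw [hw1, mul_one, ← dist_eq_norm]; exact hwu)
  rw [inner_sub_left, real_inner_self_eq_norm_sq, hw1] at h1
  have h2 : inner ℝ u v = ‖v‖ * inner ℝ u w := by
    conv_lhs => rw [hvw]
    rw [real_inner_smul_right]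
  rw [h2, mul_comm]
  exact mul_lt_mul_of_pos_left (by linarith) hv0

theorem decaysAtRate_norm_sum {E : Type*} [NormedAddCommGroup E] [InnerProductSpace ℝ E]
    [FiniteDimensional ℝ E] [MeasurableSpace E] [BorelSpace E]
    {Ω : Type*} [MeasurableSpace Ω] {μ : Measure Ω} [IsProbabilityMeasure μ]
    {R : Ω → ℝ} {β c : ℝ} (hW : IsWeibull μ R β c) (hR : Measurable R) (hβ : 0 < β)
    (hβ1 : β < 1) (hc : 0 < c) {Z : Ω → E} (hZ : Integrable Z μ) (hmean : ∫ ω, Z ω ∂μ = 0)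
    (hZR : ∀ᵐ ω ∂μ, ‖Z ω‖ ≤ R ω)
    {Ω' : Type*} [MeasurableSpace Ω'] {P : Measure Ω'} [IsProbabilityMeasure P]
    {Y : ℕ → Ω' → E} (hindep : iIndepFun Y P)
    (hident : ∀ i, IdentDistrib (Y i) Z P μ) {a : ℝ} (ha : 0 < a) :
    DecaysAtRate β (c * a ^ β)
      (fun n => P.real {ω | n * a < ‖∑ i ∈ Finset.range n, Y i ω‖}) := by
  refine .of_forall_lt fun κ hκ => ?_
  obtain ⟨b, hb0, hba, hκb⟩ : ∃ b, 0 < b ∧ b < a ∧ κ < c * b ^ β := by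
    have hcont : Tendsto (fun b : ℝ => c * b ^ β) (𝓝[<] a) (𝓝 (c * a ^ β)) :=
      (((Real.continuousAt_rpow_const a β (.inr hβ.le)).tendsto).const_mul c).mono_left
        nhdsWithin_le_nhds
    obtain ⟨b, h1, h2⟩ := ((hcont.eventually_const_lt hκ).and
      (Ioo_mem_nhdsLT ha)).exists
    exact ⟨b, h2.1, h2.2, h1⟩
  -- With `ε = 1 - b / a`, a sum of norm above `n a` has a projection above `n b` on some direction
  -- of the net.
  obtain ⟨t, ht1, ht⟩ := exists_finset_inner_gt (E := E)
    (by rw [sub_pos, div_lt_one ha]; exact hba : 0 < 1 - b / a)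
  have hdec : ∀ u ∈ t, DecaysAtRate β (c * b ^ β)
      (fun n => P.real {ω | n * b < ∑ i ∈ Finset.range n, inner ℝ u (Y i ω)}) := by
    intro u hu
    have hum : Measurable fun y : E => inner ℝ u y := by fun_prop
    refine decaysAtRate_sum hW hR hβ hβ1 hc (ζ := fun ω => inner ℝ u (Z ω))
      (hZ.const_inner u) ?_ ?_ (hindep.comp _ fun _ => hum) (fun i => (hident i).comp hum) hb0
    · rw [integral_inner hZ, hmean, inner_zero_right]
    · filter_upwards [hZR] with ω hω
      refine ((abs_real_inner_le_norm _ _).trans ?_)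
      rwa [ht1 u hu, one_mul]
  have hdec' : DecaysAtRate β κ (fun n => ∑ u ∈ t,
      P.real {ω | n * b < ∑ i ∈ Finset.range n, inner ℝ u (Y i ω)}) := fun κ' hκ' =>
    DecaysAtRate.finset_sum hβ t hdec κ' (by linarith)
  refine hdec'.mono (.of_forall fun n => ?_)
  refine (measureReal_mono ?_ (measure_ne_top _ _)).trans (measureReal_biUnion_finset_le t _)
  intro ω hω
  have hω' : n * a < ‖∑ i ∈ Finset.range n, Y i ω‖ := hω
  have hpos : 0 < ‖∑ i ∈ Finset.range n, Y i ω‖ :=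
    lt_of_le_of_lt (by positivity) hω'
  obtain ⟨u, hu, hlt⟩ := ht _ (norm_pos_iff.1 hpos)
  refine Set.mem_iUnion₂.2 ⟨u, hu, ?_⟩
  show n * b < ∑ i ∈ Finset.range n, inner ℝ u (Y i ω)
  rw [← inner_sum]
  refine lt_of_le_of_lt ?_ hlt
  rw [sub_sub_cancel]
  calc n * b = b / a * (n * a) := by field_simp
    _ ≤ _ := by gcongr

/-! ### Lower bound by a single big jump -/

/-- Choose `s` just above `a / M` and `m < M` with `m s = a + δ`, `δ > 0`. If the last of `N`
increments has norm above `N (a + δ)` and the others sum to norm at most `N δ`, the total exceeds `N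
a`. The two events are independent, and the second has probability at least `1/2` for large `N` by
the law of large numbers. -/
theorem eventually_exp_le_norm_sum {E : Type*} [NormedAddCommGroup E] [NormedSpace ℝ E]
    [CompleteSpace E] [SecondCountableTopology E] [MeasurableSpace E] [BorelSpace E]
    {Ω : Type*} [MeasurableSpace Ω] {μ : Measure Ω}
    {β c : ℝ} (hβ : 0 < β) {Z : Ω → E} (hZ : Integrable Z μ)
    (hmean : ∫ ω, Z ω ∂μ = 0) {M : ℝ} (hM : 0 < M)
    (htail : ∀ m, 0 < m → m < M → ∃ p > 0, ∀ᶠ x : ℝ in atTop,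
      p * Real.exp (-(c * x ^ β)) ≤ μ.real {ω | m * x < ‖Z ω‖})
    {Ω' : Type*} [MeasurableSpace Ω'] {P : Measure Ω'} [IsProbabilityMeasure P]
    {Y : ℕ → Ω' → E} (hindep : iIndepFun Y P)
    (hident : ∀ i, IdentDistrib (Y i) Z P μ) {a : ℝ} (ha : 0 < a)
    {κ : ℝ} (hκ : c * (a / M) ^ β < κ) :
    ∀ᶠ n : ℕ in atTop, Real.exp (-(κ * (n : ℝ) ^ β)) ≤
      P.real {ω | n * a < ‖∑ i ∈ Finset.range n, Y i ω‖} := by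
  obtain ⟨s, hs, hsκ⟩ : ∃ s, a / M < s ∧ c * s ^ β < κ := by
    have hcont : Tendsto (fun s : ℝ => c * s ^ β) (𝓝[>] (a / M)) (𝓝 (c * (a / M) ^ β)) :=
      (((Real.continuousAt_rpow_const (a / M) β (.inr hβ.le)).tendsto).const_mul c).mono_left
        nhdsWithin_le_nhds
    obtain ⟨s, h1, h2⟩ := ((hcont.eventually_lt_const hκ).and self_mem_nhdsWithin).exists
    exact ⟨s, h2, h1⟩
  have hs0 : 0 < s := (by positivity : 0 < a / M).trans hs
  obtain ⟨m, hm1, hmM⟩ : ∃ m, a / s < m ∧ m < M :=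
    exists_between ((div_lt_iff₀ hs0).2 ((div_lt_iff₀' hM).1 hs))
  have hm0 : 0 < m := (by positivity : 0 < a / s).trans hm1
  have hδ : 0 < m * s - a := sub_pos.2 ((div_lt_iff₀ hs0).1 hm1)
  set δ := m * s - a with hδdef
  obtain ⟨p, hp, hpx⟩ := htail m hm0 hmM
  have hYm : ∀ i, AEMeasurable (Y i) P := fun i => (hident i).aemeasurable_fst
  have hlln : TendstoInMeasure P (fun (n : ℕ) ω => (n : ℝ)⁻¹ • ∑ i ∈ Finset.range n, Y i ω)
      atTop (fun _ => (0 : E)) := by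
    refine tendstoInMeasure_of_tendsto_ae (fun n => ?_) ?_
    · have : AEMeasurable (fun ω => ∑ i ∈ Finset.range n, Y i ω) P :=
        Finset.aemeasurable_fun_sum _ fun i _ => hYm i
      exact (this.aestronglyMeasurable).const_smul _
    · have := strong_law_ae Y ((hident 0).integrable_iff.2 hZ)
        (fun i j hij => hindep.indepFun hij) (fun i => (hident i).trans (hident 0).symm)
      rwa [(hident 0).integral_eq, hmean] at this
  have hhalf := (tendstoInMeasure_iff_measureReal_norm.1 hlln δ hδ).eventually_le_const
    (show (0 : ℝ) < 1 / 2 by norm_num)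
  have hsucc : Tendsto (fun n : ℕ => n + 1) atTop atTop := tendsto_add_atTop_nat 1
  have hxn : Tendsto (fun n : ℕ => s * ((n + 1 : ℕ) : ℝ)) atTop atTop :=
    (tendsto_natCast_atTop_atTop.comp hsucc).const_mul_atTop hs0
  -- Pass to `n + 1` increments, so that `Y n` is the big jump and the first `n` form the
  -- independent remainder.
  rw [← map_add_atTop_eq_nat 1, eventually_map]
  filter_upwards [hhalf, hxn.eventually hpx, eventually_gt_atTop 0, hsucc.eventually
    (eventually_const_le_exp hβ (sub_pos.2 hsκ) (2 / p))] with n h1 h2 hn0 h3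
  have hn0' : (0 : ℝ) < n := by exact_mod_cast hn0
  set N : ℝ := ((n + 1 : ℕ) : ℝ) with hN
  have hnN : (n : ℝ) ≤ N := by rw [hN]; push_cast; linarith
  have hN0 : 0 < N := hn0'.trans_le hnN
  set A : Set Ω' := {ω | ‖∑ i ∈ Finset.range n, Y i ω‖ ≤ N * δ} with hA
  set B : Set Ω' := {ω | N * (m * s) < ‖Y n ω‖} with hB
  have hAhalf : 1 / 2 ≤ P.real A := by
    have hcover : (Set.univ : Set Ω') ⊆
        A ∪ {ω | δ ≤ ‖(n : ℝ)⁻¹ • ∑ i ∈ Finset.range n, Y i ω - 0‖} := by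
      intro ω _
      by_cases hω : ‖∑ i ∈ Finset.range n, Y i ω‖ ≤ N * δ
      · exact Or.inl hω
      · right
        show δ ≤ ‖(n : ℝ)⁻¹ • ∑ i ∈ Finset.range n, Y i ω - 0‖
        rw [sub_zero, norm_smul, norm_inv, Real.norm_natCast, le_inv_mul_iff₀ hn0']
        exact (mul_le_mul_of_nonneg_right hnN hδ.le).trans (not_le.1 hω).le
    have h4 := (measureReal_mono (μ := P) hcover).trans (measureReal_union_le _ _)
    rw [probReal_univ] at h4
    linarith
  have hBp : p * Real.exp (-(c * s ^ β * N ^ β)) ≤ P.real B := by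
    have h5 : P.real B = μ.real {ω | m * (s * N) < ‖Z ω‖} := by
      have hset : MeasurableSet {y : E | m * (s * N) < ‖y‖} :=
        measurableSet_lt measurable_const measurable_norm
      rw [hB, show N * (m * s) = m * (s * N) by ring, measureReal_def, measureReal_def]
      exact congrArg _ ((hident n).measure_mem_eq hset)
    rw [h5]
    rwa [Real.mul_rpow hs0.le hN0.le, ← mul_assoc c] at h2
  have hAB : P.real (A ∩ B) = P.real A * P.real B := by
    have hind := hindep.indepFun_sum_range_succ₀ hYm n
    have h6 := hind.measure_inter_preimage_eq_mul {y : E | ‖y‖ ≤ N * δ}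
      {y : E | N * (m * s) < ‖y‖} (measurableSet_le measurable_norm measurable_const)
      (measurableSet_lt measurable_const measurable_norm)
    have h7 : (∑ j ∈ Finset.range n, Y j) ⁻¹' {y : E | ‖y‖ ≤ N * δ} = A := by
      ext ω; simp [hA]
    rw [h7] at h6
    simp only [measureReal_def]
    rw [← ENNReal.toReal_mul]
    exact congrArg _ h6
  have hsub : A ∩ B ⊆ {ω | N * a < ‖∑ i ∈ Finset.range (n + 1), Y i ω‖} := by
    rintro ω ⟨hωA, hωB⟩
    have hωA' : ‖∑ i ∈ Finset.range n, Y i ω‖ ≤ N * δ := hωA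
    have hωB' : N * (m * s) < ‖Y n ω‖ := hωB
    show N * a < ‖∑ i ∈ Finset.range (n + 1), Y i ω‖
    rw [Finset.sum_range_succ]
    have h8 := norm_sub_le_norm_add (Y n ω) (∑ i ∈ Finset.range n, Y i ω)
    rw [add_comm (Y n ω)] at h8
    have h9 : N * (m * s) - N * δ = N * a := by rw [hδdef]; ring
    linarith
  -- The gap `κ - c s^β` absorbs the constant factors `1/2` and `p`.
  have h10 : Real.exp (-(κ * N ^ β)) * (2 / p) ≤ Real.exp (-(c * s ^ β * N ^ β)) := by
    calc Real.exp (-(κ * N ^ β)) * (2 / p)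
        ≤ Real.exp (-(κ * N ^ β)) * Real.exp ((κ - c * s ^ β) * N ^ β) := by gcongr
      _ = _ := by rw [← Real.exp_add]; congr 1; ring
  calc Real.exp (-(κ * N ^ β)) = 1 / 2 * (p * (Real.exp (-(κ * N ^ β)) * (2 / p))) := by
        field_simp
    _ ≤ 1 / 2 * (p * Real.exp (-(c * s ^ β * N ^ β))) := by gcongr
    _ ≤ P.real A * P.real B := by gcongr
    _ = P.real (A ∩ B) := hAB.symm
    _ ≤ _ := measureReal_mono hsub

theorem tendsto_log_div {β c K : ℝ} (hβ : 0 < β) (hc : 0 < c) {h : ℝ → ℝ}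
    (hh : (fun x : ℝ => c * x ^ β) ~[atTop] h) {f : ℕ → ℝ} (hupper : DecaysAtRate β (c * K) f)
    (hlower : ∀ κ, c * K < κ → ∀ᶠ n : ℕ in atTop, Real.exp (-(κ * (n : ℝ) ^ β)) ≤ f n) :
    (∀ᶠ n in atTop, 0 < f n) ∧ Tendsto (fun n : ℕ => Real.log (f n) / h n) atTop (𝓝 (-K)) := by
  have hpos : ∀ᶠ n in atTop, 0 < f n := by
    filter_upwards [hlower (c * K + 1) (by linarith)] with n hn
    exact (Real.exp_pos _).trans_le hn
  refine ⟨hpos, ?_⟩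
  have hN : ∀ᶠ n : ℕ in atTop, 0 < (n : ℝ) ^ β :=
    (tendsto_natCast_rpow hβ).eventually_gt_atTop 0
  have h1 : Tendsto (fun n : ℕ => Real.log (f n) / (c * (n : ℝ) ^ β)) atTop (𝓝 (-K)) := by
    refine tendsto_order.2 ⟨fun l hl => ?_, fun l hl => ?_⟩
    -- The midpoint of `c K` and `-c l` is an admissible rate that still leaves a strict inequality
    -- at `l`.
    · have hlt : c * K < (c * K + c * -l) / 2 := by nlinarith
      have hlt' : (c * K + c * -l) / 2 < c * -l := by nlinarith
      filter_upwards [hlower _ hlt, hN] with n hn hn0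
      rw [lt_div_iff₀ (by positivity)]
      have h2 := Real.log_le_log (Real.exp_pos _) hn
      rw [Real.log_exp] at h2
      have h3 := mul_lt_mul_of_pos_right hlt' hn0
      linarith
    · have hlt : (c * K + c * -l) / 2 < c * K := by nlinarith
      have hlt' : c * -l < (c * K + c * -l) / 2 := by nlinarith
      filter_upwards [hupper _ hlt, hN, hpos] with n hn hn0 hf
      rw [div_lt_iff₀ (by positivity)]
      have h2 := Real.log_le_log hf hn
      rw [Real.log_exp] at h2
      have h3 := mul_lt_mul_of_pos_right hlt' hn0
      linarith
  have hne : ∀ᶠ x : ℝ in atTop, h x ≠ 0 := by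
    have h0 : ∀ᶠ x : ℝ in atTop, c * x ^ β ≠ 0 := by
      filter_upwards [eventually_gt_atTop 0] with x hx
      positivity
    filter_upwards [hh.exists_eq_mul.choose_spec.2, h0] with x hx hx0 hzero
    exact hx0 (by rw [hx]; simp [hzero])
  have h2 : Tendsto (fun n : ℕ => c * (n : ℝ) ^ β / h n) atTop (𝓝 1) :=
    ((isEquivalent_iff_tendsto_one hne).1 hh).comp tendsto_natCast_atTop_atTop
  have h3 := h1.mul h2
  rw [mul_one] at h3
  refine h3.congr' ?_
  filter_upwards [hN] with n hn
  have : c * (n : ℝ) ^ β ≠ 0 := by positivity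
  field_simp

/-! ### The ellipsoid -/

section

variable {d : ℕ}

theorem toEuclideanLin_apply_of_isDiag {D : Matrix (Fin d) (Fin d) ℝ} (hD : D.IsDiag)
    (x : EuclideanSpace ℝ (Fin d)) (k : Fin d) :
    Matrix.toEuclideanLin D x k = D k k * x k := by
  conv_lhs => rw [← hD.diagonal_diag]
  simp [Matrix.toLpLin_apply, Matrix.mulVec_diagonal]

theorem continuous_toEuclideanLin (D : Matrix (Fin d) (Fin d) ℝ) :
    Continuous (Matrix.toEuclideanLin D) :=
  LinearMap.continuous_of_finiteDimensional _

theorem isCompact_ellipsoid (A : Matrix (Fin d) (Fin d) ℝ) : IsCompact (ellipsoid A) :=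
  (isCompact_sphere 0 1).image (continuous_toEuclideanLin A)

theorem measurableSet_ellipsoid (A : Matrix (Fin d) (Fin d) ℝ) : MeasurableSet (ellipsoid A) :=
  (isCompact_ellipsoid A).isClosed.measurableSet

theorem norm_le_mul_norm_of_forall_abs_le {x y : EuclideanSpace ℝ (Fin d)} {M : ℝ} (hM : 0 ≤ M)
    (h : ∀ k, |y k| ≤ M * |x k|) : ‖y‖ ≤ M * ‖x‖ := by
  refine abs_le_of_sq_le_sq' ?_ (by positivity) |>.2
  rw [mul_pow, EuclideanSpace.norm_sq_eq, EuclideanSpace.norm_sq_eq, Finset.mul_sum]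
  refine Finset.sum_le_sum fun k _ => ?_
  rw [← mul_pow]
  exact pow_le_pow_left₀ (norm_nonneg _) (h k) 2

theorem mem_ellipsoid_of_sum_eq_one {A : Matrix (Fin d) (Fin d) ℝ} (hA : A.IsDiag)
    (hApos : ∀ k, 0 < A k k) {y : EuclideanSpace ℝ (Fin d)} (hy : ∑ k, (y k / A k k) ^ 2 = 1) :
    y ∈ ellipsoid A := by
  refine ⟨WithLp.toLp 2 fun k => y k / A k k, ?_, ?_⟩
  · rw [mem_sphere_zero_iff_norm, EuclideanSpace.norm_eq]
    simp only [Real.norm_eq_abs, sq_abs, hy, Real.sqrt_one]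
  · ext k
    have := (hApos k).ne'
    simp only [toEuclideanLin_apply_of_isDiag hA]
    field_simp

/-- Forgetting coordinate `k` is 1-Lipschitz, so it does not increase `μH[d - 1]`. The image of the
patch contains a neighbourhood of `0` in `ℝ^(d-1)`, where this measure is Lebesgue measure. -/
theorem hausdorffMeasure_ellipsoid_inter_pos {A : Matrix (Fin d) (Fin d) ℝ} (hA : A.IsDiag)
    (hApos : ∀ k, 0 < A k k) (k : Fin d) {U : Set (EuclideanSpace ℝ (Fin d))} (hU : IsOpen U)
    (hkU : EuclideanSpace.single k (A k k) ∈ U) :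
    0 < μH[(d : ℝ) - 1] (ellipsoid A ∩ U) := by
  classical
  let ι := {j : Fin d // j ≠ k}
  have hcard : ((Fintype.card ι : ℕ) : ℝ) = (d : ℝ) - 1 := by
    have hd : 1 ≤ d := Fin.pos k
    simp [ι, Fintype.card_subtype_compl, Nat.cast_sub hd]
  let π : EuclideanSpace ℝ (Fin d) → (ι → ℝ) := fun y j => y j
  have hπ : LipschitzWith 1 π := LipschitzWith.of_dist_le_mul fun x y => by
    rw [NNReal.coe_one, one_mul, dist_pi_le_iff dist_nonneg]
    intro j
    rw [dist_eq_norm, dist_eq_norm]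
    exact PiLp.norm_apply_le (x - y) (j : Fin d)
  let r : (ι → ℝ) → ℝ := fun z => 1 - ∑ j : ι, (z j / A j j) ^ 2
  have hr : Continuous r := by fun_prop
  -- A right inverse of `π`: it solves the equation of the ellipsoid for the nonnegative `k`-th
  -- coordinate wherever `r z ≥ 0`.
  let γ : (ι → ℝ) → EuclideanSpace ℝ (Fin d) := fun z =>
    WithLp.toLp 2 fun j => if hj : j ≠ k then z ⟨j, hj⟩ else A k k * Real.sqrt (r z)
  have hγ : Continuous γ := by
    refine (PiLp.continuous_toLp 2 _).comp (continuous_pi fun j => ?_)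
    split_ifs
    · fun_prop
    · fun_prop
  have hγk : ∀ z, γ z k = A k k * Real.sqrt (r z) := fun z => by simp [γ]
  have hγj : ∀ z (j : ι), γ z j = z j := fun z j => by simp [γ, j.2]
  have hγ0 : γ 0 = EuclideanSpace.single k (A k k) := by
    ext j
    by_cases hj : j = k
    · subst hj; rw [hγk]; simp [r]
    · rw [hγj 0 ⟨j, hj⟩]; simp [hj]
  have hnhds : ∀ᶠ z in 𝓝 (0 : ι → ℝ), γ z ∈ U ∧ 0 < r z := by
    refine (hγ.continuousAt.eventually_mem (hU.mem_nhds ?_)).and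
      (hr.continuousAt.eventually_const_lt ?_)
    · rwa [hγ0]
    · simp [r]
  have hmem : {z | γ z ∈ U ∧ 0 < r z} ⊆ π '' (ellipsoid A ∩ U) := by
    rintro z ⟨hzU, hrz⟩
    refine ⟨γ z, ⟨mem_ellipsoid_of_sum_eq_one hA hApos ?_, hzU⟩, funext fun j => hγj z j⟩
    rw [Fintype.sum_eq_add_sum_subtype_ne _ k, hγk, mul_div_cancel_left₀ _ (hApos k).ne',
      Real.sq_sqrt hrz.le]
    simp only [hγj, r]
    exact sub_add_cancel _ _
  have hvol : 0 < (volume : Measure (ι → ℝ)) (π '' (ellipsoid A ∩ U)) :=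
    Measure.measure_pos_of_mem_nhds _ (Filter.mem_of_superset hnhds hmem)
  rw [← hausdorffMeasure_pi_real, hcard] at hvol
  refine hvol.trans_le ((hπ.hausdorffMeasure_image_le ?_ _).trans ?_)
  · rw [← hcard]; exact Nat.cast_nonneg _
  · simp

end

/-! ### The ruin limit of a strategy -/

theorem IsLogTail.isEquivalent_rpow {Ω : Type*} [MeasurableSpace Ω] {μ : Measure Ω} {R : Ω → ℝ}
    {β c : ℝ} {h : ℝ → ℝ} (hh : IsLogTail μ R h) (hW : IsWeibull μ R β c) :
    (fun x : ℝ => c * x ^ β) ~[atTop] h := by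
  refine hh.equiv.congr_left ?_
  filter_upwards [eventually_ge_atTop 0] with x hx
  rw [hW x hx, Real.log_exp, neg_neg]

theorem IsAngular.exists_le_measureReal_inter {d : ℕ} {Ω : Type*} [MeasurableSpace Ω]
    {μ : Measure Ω} [IsProbabilityMeasure μ] {R : Ω → ℝ} (hR : Measurable R)
    {Θ : Ω → EuclideanSpace ℝ (Fin d)} {S E : Set (EuclideanSpace ℝ (Fin d))}
    (hang : IsAngular μ R Θ E) {β c : ℝ} (hW : IsWeibull μ R β c) (hSE : S ⊆ E)
    (hS : MeasurableSet S) (hpos : 0 < μH[(d : ℝ) - 1] S) :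
    ∃ p > 0, ∀ᶠ x : ℝ in atTop,
      p * Real.exp (-(c * x ^ β)) ≤ μ.real ({ω | x < R ω} ∩ Θ ⁻¹' S) := by
  have hlim := (ENNReal.tendsto_toReal (measure_ne_top μ _)).comp
    (hang.asymp_indep S hSE hS hpos)
  have hp : 0 < (μ (Θ ⁻¹' S)).toReal :=
    ENNReal.toReal_pos (hang.pos S hSE hS hpos).ne' (measure_ne_top _ _)
  refine ⟨(μ (Θ ⁻¹' S)).toReal / 2, half_pos hp, ?_⟩
  filter_upwards [hlim.eventually_const_le (half_lt_self hp), eventually_ge_atTop 0] with x hx hx0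
  rw [measureReal_def, ← cond_mul_eq_inter (measurableSet_lt measurable_const hR),
    ENNReal.toReal_mul, ← hW x hx0]
  exact mul_le_mul_of_nonneg_right hx measureReal_nonneg

/-- The largest semi-axis of the ellipsoid `Q A (𝕊^{d-1})` for diagonal matrices `Q` and `A`. -/
noncomputable def maxAxis {d : ℕ} (A Q : Matrix (Fin d) (Fin d) ℝ) : ℝ := ⨆ k, Q k k * A k k

theorem le_maxAxis {d : ℕ} (A Q : Matrix (Fin d) (Fin d) ℝ) (k : Fin d) :
    Q k k * A k k ≤ maxAxis A Q :=
  le_ciSup (f := fun k => Q k k * A k k) (Set.finite_range _).bddAbove k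

/-- Above, the increments are dominated by `M R`, which is Weibull with constant `c / M^β`. Below,
for each `m < M` the directions that `Q` maps to norm above `m` contain a neighbourhood of the tip
of a longest axis in the ellipsoid; it has positive surface measure, and asymptotic independence
preserves the tail of `R` there up to a constant. -/
theorem hasLogRuinLimit_strategy {d : ℕ} [NeZero d]
    {Ω : Type*} [MeasurableSpace Ω] {μ : Measure Ω} [IsProbabilityMeasure μ]
    {R : Ω → ℝ} (hR : Measurable R) {Θ : Ω → EuclideanSpace ℝ (Fin d)}
    {A : Matrix (Fin d) (Fin d) ℝ} (hA : A.IsDiag) (hApos : ∀ k, 0 < A k k)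
    (hang : IsAngular μ R Θ (ellipsoid A)) {β c : ℝ} (hβ : 0 < β) (hβ1 : β < 1) (hc : 0 < c)
    (hW : IsWeibull μ R β c) {h : ℝ → ℝ} (hh : IsLogTail μ R h)
    {Ω' : Type*} [MeasurableSpace Ω'] {P : Measure Ω'} [IsProbabilityMeasure P]
    {X : ℕ → Ω' → EuclideanSpace ℝ (Fin d)} (hindep : iIndepFun X P)
    (hident : ∀ i, IdentDistrib (X i) (fun ω => R ω • Θ ω) P μ)
    {a : ℝ} (ha : 0 < a) {Q : Matrix (Fin d) (Fin d) ℝ} (hQ : Q.IsDiag)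
    (hQpos : ∀ k, 0 < Q k k) :
    HasLogRuinLimit P h a (fun n ω => Matrix.toEuclideanLin Q (walkMean X n ω))
      (-(a / maxAxis A Q) ^ β) := by
  obtain ⟨k, hk⟩ := exists_eq_ciSup_of_finite (f := fun k => Q k k * A k k)
  change Q k k * A k k = maxAxis A Q at hk
  set M := maxAxis A Q with hMdef
  have hM : 0 < M := hk ▸ mul_pos (hQpos k) (hApos k)
  set T := (Matrix.toEuclideanLin Q).toContinuousLinearMap with hT
  have hTQ : ∀ x, T x = Matrix.toEuclideanLin Q x := fun x => rfl
  have hTm : Measurable T := T.continuous.measurable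
  have hindepT : iIndepFun (fun i ω => T (X i ω)) P := hindep.comp _ fun _ => hTm
  have hidentT : ∀ i, IdentDistrib (fun ω => T (X i ω)) (fun ω => T (R ω • Θ ω)) P μ :=
    fun i => (hident i).comp hTm
  have hZ : Integrable (fun ω => T (R ω • Θ ω)) μ := T.integrable_comp hang.integrable
  have hmean : ∫ ω, T (R ω • Θ ω) ∂μ = 0 := by
    rw [T.integral_comp_comm hang.integrable, hang.mean_zero, map_zero]
  have hZR : ∀ᵐ ω ∂μ, ‖T (R ω • Θ ω)‖ ≤ M * R ω := by
    filter_upwards [hang.mem, hW.ae_pos hR hβ] with ω hω hpos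
    obtain ⟨x, hx, hxΘ⟩ := hω
    have h1 : ‖T (Θ ω)‖ ≤ M * ‖x‖ := by
      refine norm_le_mul_norm_of_forall_abs_le hM.le fun j => ?_
      rw [hTQ, ← hxΘ]
      simp only [toEuclideanLin_apply_of_isDiag hA, toEuclideanLin_apply_of_isDiag hQ]
      rw [← mul_assoc, abs_mul, abs_of_pos (mul_pos (hQpos j) (hApos j))]
      exact mul_le_mul_of_nonneg_right (le_maxAxis A Q j) (abs_nonneg _)
    rw [mem_sphere_zero_iff_norm.1 hx, mul_one] at h1
    rw [map_smul, norm_smul, Real.norm_of_nonneg hpos.le, mul_comm]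
    exact mul_le_mul_of_nonneg_right h1 hpos.le
  have hrate : c / M ^ β * a ^ β = c * (a / M) ^ β := by
    rw [Real.div_rpow ha.le hM.le]; ring
  have hupper : DecaysAtRate β (c * (a / M) ^ β)
      (fun n => P.real {ω | n * a < ‖∑ i ∈ Finset.range n, T (X i ω)‖}) := by
    rw [← hrate]
    exact decaysAtRate_norm_sum (hW.const_mul hM) (hR.const_mul M) hβ hβ1 (by positivity) hZ hmean
      hZR hindepT hidentT ha
  have htail : ∀ m, 0 < m → m < M → ∃ p > 0, ∀ᶠ x : ℝ in atTop,
      p * Real.exp (-(c * x ^ β)) ≤ μ.real {ω | m * x < ‖T (R ω • Θ ω)‖} := by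
    intro m hm0 hm
    have hU : IsOpen {y | m < ‖T y‖} := isOpen_lt continuous_const T.continuous.norm
    have hkU : EuclideanSpace.single k (A k k) ∈ {y | m < ‖T y‖} := by
      show m < ‖T (EuclideanSpace.single k (A k k))‖
      have hTk : T (EuclideanSpace.single k (A k k)) k = M := by
        rw [hTQ, toEuclideanLin_apply_of_isDiag hQ]
        simpa using hk
      have hle := PiLp.norm_apply_le (T (EuclideanSpace.single k (A k k))) k
      rw [hTk, Real.norm_of_nonneg hM.le] at hle
      exact hm.trans_le hle
    obtain ⟨p, hp, hpx⟩ := hang.exists_le_measureReal_inter hR hW Set.inter_subset_left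
      ((measurableSet_ellipsoid A).inter hU.measurableSet)
      (hausdorffMeasure_ellipsoid_inter_pos hA hApos k hU hkU)
    refine ⟨p, hp, ?_⟩
    filter_upwards [hpx, eventually_ge_atTop 0] with x hx hx0
    refine hx.trans (measureReal_mono ?_)
    rintro ω ⟨hωR, hωS⟩
    have h1 : x < R ω := hωR
    have h2 : m < ‖T (Θ ω)‖ := hωS.2
    show m * x < ‖T (R ω • Θ ω)‖
    rw [map_smul, norm_smul, Real.norm_of_nonneg (hx0.trans h1.le), mul_comm]
    exact mul_lt_mul'' h1 h2 hx0 hm0.le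
  obtain ⟨hpos, hlim⟩ := tendsto_log_div hβ hc (hh.isEquivalent_rpow hW) hupper
    fun κ hκ => eventually_exp_le_norm_sum hβ hZ hmean hM htail hindepT hidentT ha hκ
  have hset : ∀ᶠ n : ℕ in atTop, {ω | n * a < ‖∑ i ∈ Finset.range n, T (X i ω)‖} =
      {ω | a < ‖Matrix.toEuclideanLin Q (walkMean X n ω)‖} := by
    filter_upwards [eventually_gt_atTop 0] with n hn
    have hn' : (0 : ℝ) < n := by exact_mod_cast hn
    ext ω
    show n * a < ‖∑ i ∈ Finset.range n, T (X i ω)‖ ↔ a < ‖T (walkMean X n ω)‖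
    rw [walkMean, map_smul, map_sum, norm_smul, norm_inv, Real.norm_natCast, lt_inv_mul_iff₀ hn']
  constructor
  · filter_upwards [hpos, hset] with n h1 h2
    rw [h2] at h1
    exact (ENNReal.toReal_pos_iff.1 h1).1
  · refine hlim.congr' ?_
    filter_upwards [hset] with n h2
    rw [h2]

/-! ### The optimal strategy -/

section

variable {d : ℕ} {A Q : Matrix (Fin d) (Fin d) ℝ}

theorem optimalStrategy_eq_diagonal (hA : A.IsDiag) (hApos : ∀ k, 0 < A k k) :
    optimalStrategy A = Matrix.diagonal fun k => (⨅ j, A j j) / A k k := by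
  have hinv : A⁻¹ = Matrix.diagonal fun k => (A k k)⁻¹ := by
    refine Matrix.inv_eq_right_inv ?_
    conv_lhs => rw [← hA.diagonal_diag]
    rw [Matrix.diagonal_mul_diagonal, ← Matrix.diagonal_one]
    congr 1
    ext k
    simp [(hApos k).ne']
  rw [optimalStrategy, hinv, ← Matrix.diagonal_smul]
  rfl

theorem optimalStrategy_apply_self (hA : A.IsDiag) (hApos : ∀ k, 0 < A k k) (k : Fin d) :
    optimalStrategy A k k = (⨅ j, A j j) / A k k := by
  rw [optimalStrategy_eq_diagonal hA hApos, Matrix.diagonal_apply_eq]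

theorem iInf_diag_le (A : Matrix (Fin d) (Fin d) ℝ) (k : Fin d) : ⨅ j, A j j ≤ A k k :=
  ciInf_le (Set.finite_range fun j => A j j).bddBelow k

theorem optimalStrategy_mem_strategies [NeZero d] (hA : A.IsDiag) (hApos : ∀ k, 0 < A k k) :
    optimalStrategy A ∈ strategies d := by
  obtain ⟨k, hk⟩ := exists_eq_ciInf_of_finite (f := fun j => A j j)
  have hm : 0 < ⨅ j, A j j := hk ▸ hApos k
  refine ⟨?_, fun j => ?_, k, ?_⟩
  · rw [optimalStrategy_eq_diagonal hA hApos]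
    exact Matrix.isDiag_diagonal _
  · rw [optimalStrategy_apply_self hA hApos]
    exact ⟨div_pos hm (hApos j), (div_le_one (hApos j)).2 (iInf_diag_le A j)⟩
  · rw [optimalStrategy_apply_self hA hApos, ← hk]
    exact div_self (hApos k).ne'

theorem maxAxis_optimalStrategy [NeZero d] (hA : A.IsDiag) (hApos : ∀ k, 0 < A k k) :
    maxAxis A (optimalStrategy A) = ⨅ j, A j j := by
  have h : ∀ k, optimalStrategy A k k * A k k = ⨅ j, A j j := fun k => by
    rw [optimalStrategy_apply_self hA hApos, div_mul_cancel₀ _ (hApos k).ne']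
  simp [maxAxis, h]

theorem iInf_diag_le_maxAxis (hQ : Q ∈ strategies d) : ⨅ j, A j j ≤ maxAxis A Q := by
  obtain ⟨k, hk⟩ := hQ.2.2
  calc ⨅ j, A j j ≤ Q k k * A k k := by rw [hk, one_mul]; exact iInf_diag_le A k
    _ ≤ maxAxis A Q := le_maxAxis A Q k

/-- The bound on the largest axis bounds every `q_jj a_jj`, so `Q` lies entrywise below the optimal
strategy on the diagonal, strictly somewhere. All prices being positive, its premium is larger. -/
theorem premium_optimalStrategy_lt (hA : A.IsDiag) (hApos : ∀ k, 0 < A k k)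
    {p : Fin d → ℝ} (hp : ∀ j, 0 < p j) (hQ : Q.IsDiag) (hle : maxAxis A Q ≤ ⨅ j, A j j)
    (hne : Q ≠ optimalStrategy A) : premium p (optimalStrategy A) < premium p Q := by
  have hdiag : ∀ j, Q j j ≤ optimalStrategy A j j := fun j => by
    rw [optimalStrategy_apply_self hA hApos, le_div_iff₀ (hApos j)]
    exact (le_maxAxis A Q j).trans hle
  obtain ⟨j, hj⟩ : ∃ j, Q j j ≠ optimalStrategy A j j := by
    by_contra! hall
    refine hne ?_
    rw [optimalStrategy_eq_diagonal hA hApos, ← hQ.diagonal_diag]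
    congr 1
    ext j
    rw [← optimalStrategy_apply_self hA hApos j]
    exact hall j
  refine Finset.sum_lt_sum (fun i _ => ?_) ⟨j, Finset.mem_univ j, ?_⟩
  · exact mul_le_mul_of_nonneg_right (sub_le_sub_left (hdiag i) 1) (hp i).le
  · exact mul_lt_mul_of_pos_right (sub_lt_sub_left ((hdiag j).lt_of_ne hj) 1) (hp j)

end

end QuotaShare

theorem mainTheorem4 {d : ℕ} (hd : 0 < d)
    -- a generic increment `R Θ` on a probability space `(Ω, μ)`
    {Ω : Type*} [MeasurableSpace Ω] (μ : Measure Ω) [IsProbabilityMeasure μ]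
    (R : Ω → ℝ) (hR : Measurable R)
    (Θ : Ω → EuclideanSpace ℝ (Fin d)) (hΘ : Measurable Θ)
    (A : Matrix (Fin d) (Fin d) ℝ) (hA : A.IsDiag) (hApos : ∀ k, 0 < A k k)
    (hangular : QuotaShare.IsAngular μ R Θ (QuotaShare.ellipsoid A))
    (β c : ℝ) (hβ : β ∈ Set.Ioo (0 : ℝ) 1) (hc : 0 < c)
    (hweibull : QuotaShare.IsWeibull μ R β c)
    (h : ℝ → ℝ) (hh : QuotaShare.IsLogTail μ R h)
    -- the i.i.d. increments of the random walk, distributed as `R Θ`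
    {Ω' : Type*} [MeasurableSpace Ω'] (P : Measure Ω') [IsProbabilityMeasure P]
    (X : ℕ → Ω' → EuclideanSpace ℝ (Fin d)) (hindep : iIndepFun X P)
    (hident : ∀ i, IdentDistrib (X i) (fun ω => R ω • Θ ω) P μ)
    (p : Fin d → ℝ) (hp : ∀ j, 0 < p j)
    (a : ℝ) (ha : 0 < a) :
    ∃ (L₀ : ℝ) (L : Matrix (Fin d) (Fin d) ℝ → ℝ),
      -- the limits without reinsurance and with any strategy exist
      QuotaShare.HasLogRuinLimit P h a (QuotaShare.walkMean X) L₀ ∧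
      (∀ Q ∈ QuotaShare.strategies d,
        QuotaShare.HasLogRuinLimit P h a
          (fun n ω => Matrix.toEuclideanLin Q (QuotaShare.walkMean X n ω)) (L Q)) ∧
      QuotaShare.optimalStrategy A ∈ QuotaShare.strategies d ∧
      -- the proposed strategy does not worsen the limit
      L (QuotaShare.optimalStrategy A) ≤ L₀ ∧
      -- it is a minimiser over all strategies
      IsMinOn L (QuotaShare.strategies d) (QuotaShare.optimalStrategy A) ∧
      -- any other minimiser has a strictly larger premium
      (∀ Q ∈ QuotaShare.strategies d, IsMinOn L (QuotaShare.strategies d) Q →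
        Q ≠ QuotaShare.optimalStrategy A →
        QuotaShare.premium p (QuotaShare.optimalStrategy A) < QuotaShare.premium p Q) := by 
  have : NeZero d := ⟨hd.ne'⟩
  have hopt := QuotaShare.optimalStrategy_mem_strategies hA hApos
  have hmax := QuotaShare.maxAxis_optimalStrategy hA hApos
  have hm : 0 < ⨅ j, A j j := by
    obtain ⟨k, hk⟩ := exists_eq_ciInf_of_finite (f := fun j => A j j)
    exact hk ▸ hApos k
  -- No reinsurance is the strategy `Q = 1`, so the comparison with `L₀` is a case of minimality.
  have hone : (1 : Matrix (Fin d) (Fin d) ℝ) ∈ QuotaShare.strategies d :=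
    ⟨Matrix.isDiag_one, fun k => by simp, 0, Matrix.one_apply_eq 0⟩
  have hlim : ∀ Q ∈ QuotaShare.strategies d, QuotaShare.HasLogRuinLimit P h a
      (fun n ω => Matrix.toEuclideanLin Q (QuotaShare.walkMean X n ω))
      (-(a / QuotaShare.maxAxis A Q) ^ β) := fun Q hQ =>
    QuotaShare.hasLogRuinLimit_strategy hR hA hApos hangular hβ.1 hβ.2 hc hweibull hh hindep
      hident ha hQ.1 fun k => (hQ.2.1 k).1
  have hmin : IsMinOn (fun Q => -(a / QuotaShare.maxAxis A Q) ^ β) (QuotaShare.strategies d)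
      (QuotaShare.optimalStrategy A) := by
    intro Q hQ
    show -(a / QuotaShare.maxAxis A (QuotaShare.optimalStrategy A)) ^ β ≤
      -(a / QuotaShare.maxAxis A Q) ^ β
    have hle := QuotaShare.iInf_diag_le_maxAxis (A := A) hQ
    have hM := hm.trans_le hle
    rw [hmax]
    exact neg_le_neg (Real.rpow_le_rpow (by positivity) (by gcongr) hβ.1.le)
  refine ⟨_, fun Q => -(a / QuotaShare.maxAxis A Q) ^ β, ?_, hlim, hopt, hmin hone, hmin, ?_⟩
  · simpa using hlim 1 hone
  · intro Q hQ hQmin hne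
    refine QuotaShare.premium_optimalStrategy_lt hA hApos hp hQ.1 ?_ hne
    have hle : -(a / QuotaShare.maxAxis A Q) ^ β ≤
        -(a / QuotaShare.maxAxis A (QuotaShare.optimalStrategy A)) ^ β := hQmin hopt
    have hM := hm.trans_le (QuotaShare.iInf_diag_le_maxAxis (A := A) hQ)
    -- Since `x ↦ -(a / x)^β` is strictly increasing on `x > 0`, comparing limits is comparing
    -- largest axes.
    rw [hmax, neg_le_neg_iff, Real.rpow_le_rpow_iff (by positivity) (by positivity) hβ.1,
      div_le_div_iff_of_pos_left ha hm hM] at hle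
    exact hle
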